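/- Notation: $\mathbb{F}_4$ is the field with four elements. For a group $K$, $\gamma_1(K)=K$ and $\gamma_{k+1}(K)=[\gamma_k(K),K]$. For $N\trianglelefteq G$, $[G,{}_0N]=G$ and $[G,{}_{k+1}N]=[[G,{}_kN],N]$. For $d\ge 0$ let $\mathcal P_d$ be the power set of $\{1,\dots,d\}$, ordered by short-lex ($A<B$ iff $|A|<|B|$, or $|A|=|B|$ and $\min(A\setminus B)<\min(B\setminus A)$). For $A\in\mathcal P_d$ and $u\in G$ let $\Delta_A(u)\in G^{\mathcal P_d}$ have $B$-component $u$ if $A\subseteq B$ and $1$ otherwise, and put $$\Gamma_1^{(d)}(G,N)=\Delta_\emptyset(G)\cdot\prod_{\emptyset\ne A\in\mathcal P_d}\Delta_A\bigl(\gamma_{|A|}(N)\bigr),$$ the product being taken in short-lex order. Lemma. Let $n\ge 1$, and regard $2n\times 2n$ matrices over $\mathbb{F}_4$ as $n\times n$ block matrices $(A_{ij})$ with $2\times 2$ blocks. Let - $H$ be the set of block diagonal matrices with $n$ equal diagonal blocks $A$, $A\in SL_2(\mathbb{F}_4)$; - $M$ be the set of $(A_{ij})$ with $A_{ii}=I$,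 $A_{ij}=0$ for $i>j$, $\operatorname{tr}(A_{i,i+1})=0$, and $A_{ij}$ arbitrary for $j-i>1$; - $N$ be the set of $(A_{ij})\in M$ such that each $A_{i,i+1}$ is a scalar matrix $a_iI$ with $a_i\in\mathbb{F}_4$; - $G=HM$. Then $H$, $M$, $N$ and $G$ are subgroups of $SL_{2n}(\mathbb{F}_4)$, and: 1. $M\trianglelefteq G\le SL_{2n}(\mathbb{F}_4)$; 2. $G$ is a (finite) perfect group; 3. $N\trianglelefteq G$; 4. $\gamma_d(N)>[G,{}_dN]$ (strict containment) for all $1\le d<n$. Moreover, for every $0\le d<n$, the set $\Gamma_1^{(d)}(G,N)$ is a subdirect subgroup of the direct power $G^{2^d}=G^{\mathcal P_d}$ (it projects onto every factor), and it has a nilpotent quotient of nilpotency class exactly $d$. In particular, $G^{2^{n-1}}$ has a subdirect subgroup with a nilpotent quotient of class $n-1$. -/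

import Mathlib

open scoped Pointwise

namespace SubdirectPerfect

/-! ### The subdirect construction in `G ^ 𝒫([d])` -/

section Construction

/-- The strict short-lex order on `𝒫([d])`: `|A| < |B|`, or `|A| = |B|` and
`min (A \ B) < min (B \ A)` (the minimum of the empty set is `⊤`, so `A < A` fails). -/
def ShortLexLT {d : ℕ} (A B : Finset (Fin d)) : Prop :=
  A.card < B.card ∨ (A.card = B.card ∧ (A \ B).min < (B \ A).min)

/-- The reflexive short-lex order on `𝒫([d])`. -/
def ShortLexLE {d : ℕ} (A B : Finset (Fin d)) : Prop :=
  A = B ∨ ShortLexLT A B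

theorem min_sdiff_lt_iff {d : ℕ} (A B : Finset (Fin d)) :
    (A \ B).min < (B \ A).min ↔ ∃ a ∈ A, a ∉ B ∧ ∀ x < a, (x ∈ A ↔ x ∈ B) := by
  constructor
  · intro h
    have hne : (A \ B).Nonempty := by
      rw [Finset.nonempty_iff_ne_empty]
      intro h0
      rw [h0, Finset.min_empty] at h
      exact not_top_lt h
    have hm := Finset.min'_mem _ hne
    rw [← Finset.coe_min' hne] at h
    rw [Finset.mem_sdiff] at hm
    refine ⟨(A \ B).min' hne, hm.1, hm.2, fun x hx => ⟨fun hA => ?_, fun hB => ?_⟩⟩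
    · by_contra hB
      exact absurd (Finset.min'_le (A \ B) x (Finset.mem_sdiff.2 ⟨hA, hB⟩)) (not_le.2 hx)
    · by_contra hA
      have h1 := Finset.min_le (Finset.mem_sdiff.2 ⟨hB, hA⟩)
      exact absurd (WithTop.coe_lt_coe.1 (h.trans_le h1)) (not_lt.2 hx.le)
  · rintro ⟨a, haA, haB, hx⟩
    have h1 : (A \ B).min ≤ (a : WithTop (Fin d)) :=
      Finset.min_le (Finset.mem_sdiff.2 ⟨haA, haB⟩)
    refine lt_of_le_of_lt h1 ?_
    rcases (B \ A).eq_empty_or_nonempty with h0 | hne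
    · rw [h0, Finset.min_empty]
      exact WithTop.coe_lt_top a
    · rw [← Finset.coe_min' hne, WithTop.coe_lt_coe]
      have hm := Finset.mem_sdiff.1 (Finset.min'_mem _ hne)
      rcases lt_trichotomy a ((B \ A).min' hne) with h | h | h
      · exact h
      · exact absurd (h ▸ hm.1) haB
      · exact absurd ((hx _ h).2 hm.1) hm.2

theorem ShortLexLT.trans {d : ℕ} {A B C : Finset (Fin d)} (h1 : ShortLexLT A B)
    (h2 : ShortLexLT B C) : ShortLexLT A C := by
  unfold ShortLexLT at *
  rw [min_sdiff_lt_iff] at *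
  rcases h1 with h1 | ⟨h1, a, haA, haB, ha⟩
  · rcases h2 with h2 | ⟨h2, -⟩ <;> left <;> omega
  · rcases h2 with h2 | ⟨h2, b, hbB, hbC, hb⟩
    · left; omega
    · right
      refine ⟨h1.trans h2, ?_⟩
      rcases lt_trichotomy a b with h | h | h
      · exact ⟨a, haA, fun hC => haB ((hb a h).2 hC),
          fun x hx => (ha x hx).trans (hb x (hx.trans h))⟩
      · exact absurd (h ▸ hbB) haB
      · exact ⟨b, (ha b h).2 hbB, hbC, fun x hx => (ha x (hx.trans h)).trans (hb x hx)⟩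

theorem ShortLexLT.irrefl {d : ℕ} (A : Finset (Fin d)) : ¬ ShortLexLT A A := by
  rintro (h | ⟨-, h⟩) <;> exact lt_irrefl _ h

theorem shortLexLT_total {d : ℕ} {A B : Finset (Fin d)} (hne : A ≠ B) :
    ShortLexLT A B ∨ ShortLexLT B A := by
  rcases lt_trichotomy A.card B.card with h | h | h
  · exact Or.inl (Or.inl h)
  · rcases lt_trichotomy (A \ B).min (B \ A).min with h' | h' | h'
    · exact Or.inl (Or.inr ⟨h, h'⟩)
    · exfalso
      have hAB : (A \ B).Nonempty := by
        rw [Finset.sdiff_nonempty]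
        exact fun hs => hne (Finset.eq_of_subset_of_card_le hs h.ge)
      have hm := Finset.mem_sdiff.1 (Finset.min'_mem _ hAB)
      have hm2 : (A \ B).min' hAB ∈ B \ A := by
        apply Finset.mem_of_min
        rw [← h', Finset.coe_min']
      exact hm.2 (Finset.mem_sdiff.1 hm2).1
    · exact Or.inr (Or.inr ⟨h.symm, h'⟩)
  · exact Or.inr (Or.inl h)

instance (d : ℕ) : IsTrans (Finset (Fin d)) ShortLexLE where
  trans := by
    rintro A B C (rfl | h1) (rfl | h2)
    · exact Or.inl rfl
    · exact Or.inr h2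
    · exact Or.inr h1
    · exact Or.inr (h1.trans h2)

instance (d : ℕ) : Std.Antisymm (ShortLexLE (d := d)) where
  antisymm := by
    rintro A B (h1 | h1) (h2 | h2)
    · exact h1
    · exact h1
    · exact h2.symm
    · exact absurd (h1.trans h2) (ShortLexLT.irrefl A)

instance (d : ℕ) : Std.Total (ShortLexLE (d := d)) where
  total A B := by
    by_cases h : A = B
    · exact Or.inl (Or.inl h)
    · rcases shortLexLT_total h with h' | h'
      · exact Or.inl (Or.inr h')
      · exact Or.inr (Or.inr h')

open scoped Classical in
/-- All subsets of `[d]`, listed in increasing short-lex order. -/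
noncomputable def subsetList (d : ℕ) : List (Finset (Fin d)) :=
  (Finset.univ : Finset (Finset (Fin d))).sort ShortLexLE

open scoped Classical in
/-- `Δ_A(u) ∈ G ^ 𝒫([d])`, with `B`-component `u` if `A ⊆ B`, and `1` otherwise. -/
noncomputable def Delta {G : Type*} [Group G] {d : ℕ} (A : Finset (Fin d)) (u : G) :
    Finset (Fin d) → G :=
  fun B => if A ⊆ B then u else 1

/-- `γ_k(N)` for `k ≥ 1`, as a subgroup of `G`: `γ_1(N) = N`, `γ_{k+1}(N) = [γ_k(N), N]`. -/
def gammaSub {G : Type*} [Group G] (k : ℕ) (N : Subgroup G) : Subgroup G :=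
  N.lowerCentralSeries (k - 1)

/-- `[G, N, …, N]` with `k` copies of `N`, left associated. -/
def iterComm {G : Type*} [Group G] (N : Subgroup G) : ℕ → Subgroup G
  | 0 => ⊤
  | k + 1 => ⁅iterComm N k, N⁆

/-- The subset `Γ_k(G, N)` of `G ^ 𝒫([d])` (for `k ≥ 1`): the product, in short-lex order of `A`,
of the sets `Δ_A([G, N, …, N])` (`|A|` copies of `N`) for `|A| < k`, and `Δ_A(γ_{|A|}(N))` for
`|A| ≥ k`. -/
noncomputable def GammaSet {G : Type*} [Group G] (d k : ℕ) (N : Subgroup G) :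
    Set (Finset (Fin d) → G) :=
  ((subsetList d).map fun A =>
    Delta A '' ((if A.card < k then iterComm N A.card else gammaSub A.card N : Subgroup G) :
      Set G)).prod

/-- A subgroup of a direct product is subdirect if it projects onto every factor. -/
def IsSubdirect {ι : Type*} {G : ι → Type*} [∀ i, Group (G i)] (S : Subgroup (∀ i, G i)) : Prop :=
  ∀ i, S.map (Pi.evalMonoidHom G i) = ⊤

/-- `G` has a nilpotent quotient of class (exactly) `c`. -/
def HasNilpotentQuotientOfClass (G : Type*) [Group G] (c : ℕ) : Prop :=
  ∃ (K : Subgroup G) (_ : K.Normal),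
    Group.IsNilpotent (G ⧸ K) ∧ Group.nilpotencyClass (G ⧸ K) = c

end Construction

/-! ### The matrix groups -/

section MatrixGroups

/-- `2n × 2n` matrices, indexed as `n × n` block matrices with `2 × 2` blocks. -/
abbrev BlockMat (n : ℕ) (F : Type*) : Type _ := Matrix (Fin n × Fin 2) (Fin n × Fin 2) F

/-- The special linear group of degree `2n`. -/
abbrev SL2n (n : ℕ) (F : Type*) [Field F] : Type _ :=
  Matrix.SpecialLinearGroup (Fin n × Fin 2) F

variable {n : ℕ} {F : Type*} [Field F]

/-- The `(i, j)` block of a block matrix. -/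
def blk (X : BlockMat n F) (i j : Fin n) : Matrix (Fin 2) (Fin 2) F :=
  Matrix.of fun a b => X (i, a) (j, b)

/-- The block diagonal matrix with `n` copies of `A` on the diagonal. -/
def diagBlock (n : ℕ) (A : Matrix (Fin 2) (Fin 2) F) : BlockMat n F :=
  Matrix.of fun p q => if p.1 = q.1 then A p.2 q.2 else 0

variable (n F) in
/-- The matrices `Δ(A)` with `A ∈ SL₂(F)`. -/
def HMat : Set (BlockMat n F) :=
  {X | ∃ A : Matrix.SpecialLinearGroup (Fin 2) F, X = diagBlock n (A : Matrix (Fin 2) (Fin 2) F)}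

variable (n F) in
/-- The block upper unitriangular matrices with trace `0` blocks on the superdiagonal. -/
def MMat : Set (BlockMat n F) :=
  {X | (∀ i, blk X i i = 1) ∧ (∀ i j, j < i → blk X i j = 0) ∧
    ∀ i j : Fin n, (j : ℕ) = i + 1 → (blk X i j).trace = 0}

variable (n F) in
/-- The elements of `MMat` with scalar blocks on the superdiagonal. -/
def NMat : Set (BlockMat n F) :=
  {X | X ∈ MMat n F ∧ ∀ i j : Fin n, (j : ℕ) = i + 1 → ∃ a : F, blk X i j = a • 1}

theorem blk_one (i j : Fin n) : blk (1 : BlockMat n F) i j = if i = j then 1 else 0 := by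
  ext a b
  by_cases h : i = j <;> simp [blk, Matrix.one_apply, h]

theorem blk_mul (X Y : BlockMat n F) (i j : Fin n) :
    blk (X * Y) i j = ∑ k, blk X i k * blk Y k j := by
  ext a b
  simp [blk, Matrix.mul_apply, Matrix.sum_apply, Fintype.sum_prod_type]

theorem diagBlock_one : diagBlock n (1 : Matrix (Fin 2) (Fin 2) F) = 1 := by
  ext ⟨i, a⟩ ⟨j, b⟩
  by_cases h : i = j <;> simp [diagBlock, Matrix.one_apply, h]

theorem diagBlock_mul (A B : Matrix (Fin 2) (Fin 2) F) :
    diagBlock n (A * B) = diagBlock n A * diagBlock n B := by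
  ext ⟨i, a⟩ ⟨j, b⟩
  by_cases h : i = j <;> simp [diagBlock, Matrix.mul_apply, Fintype.sum_prod_type, h]

/-- Block upper unitriangular matrices. -/
def IsUni (X : BlockMat n F) : Prop :=
  (∀ i, blk X i i = 1) ∧ ∀ i j, j < i → blk X i j = 0

theorem blk_mul_self {X Y : BlockMat n F} (hX : ∀ i j, j < i → blk X i j = 0)
    (hY : ∀ i j, j < i → blk Y i j = 0) (i : Fin n) :
    blk (X * Y) i i = blk X i i * blk Y i i := by
  rw [blk_mul]
  refine Finset.sum_eq_single i (fun k _ hk => ?_) (by simp)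
  rcases lt_or_gt_of_ne hk with h | h
  · rw [hX i k h, zero_mul]
  · rw [hY k i h, mul_zero]

theorem blk_mul_lower {X Y : BlockMat n F} (hX : ∀ i j, j < i → blk X i j = 0)
    (hY : ∀ i j, j < i → blk Y i j = 0) (i j : Fin n) (hij : j < i) :
    blk (X * Y) i j = 0 := by
  rw [blk_mul]
  refine Finset.sum_eq_zero fun k _ => ?_
  rcases lt_or_ge k i with h | h
  · rw [hX i k h, zero_mul]
  · rw [hY k j (hij.trans_le h), mul_zero]

theorem blk_mul_super {X Y : BlockMat n F} (hX : IsUni X) (hY : IsUni Y) (i j : Fin n)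
    (hij : (j : ℕ) = i + 1) : blk (X * Y) i j = blk X i j + blk Y i j := by
  have hne : i ≠ j := by
    rintro rfl
    omega
  rw [blk_mul, ← Finset.sum_subset (Finset.subset_univ {i, j}), Finset.sum_pair hne,
    hX.1, hY.1, one_mul, mul_one, add_comm]
  intro k _ hk
  simp only [Finset.mem_insert, Finset.mem_singleton, not_or, Fin.ext_iff] at hk
  rcases lt_or_ge (k : ℕ) i with h | h
  · rw [hX.2 i k h, zero_mul]
  · rw [hY.2 k j (Fin.lt_def.2 (by omega)), mul_zero]

theorem IsUni.mul {X Y : BlockMat n F} (hX : IsUni X) (hY : IsUni Y) : IsUni (X * Y) :=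
  ⟨fun i => by rw [blk_mul_self hX.2 hY.2, hX.1, hY.1, one_mul], blk_mul_lower hX.2 hY.2⟩

theorem isUni_one : IsUni (1 : BlockMat n F) :=
  ⟨fun i => by simp [blk_one], fun i j h => by simp [blk_one, h.ne']⟩

theorem blk_one_super (i j : Fin n) (hij : (j : ℕ) = i + 1) :
    blk (1 : BlockMat n F) i j = 0 := by
  have hne : i ≠ j := by
    rintro rfl
    omega
  simp [blk_one, hne]

theorem IsUni.inv {X : SL2n n F} (hX : IsUni (X : BlockMat n F)) :
    IsUni ((X⁻¹ : SL2n n F) : BlockMat n F) := by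
  have hXY : (X : BlockMat n F) * ((X⁻¹ : SL2n n F) : BlockMat n F) = 1 := by
    rw [← Matrix.SpecialLinearGroup.coe_mul, mul_inv_cancel, Matrix.SpecialLinearGroup.coe_one]
  set Y : BlockMat n F := ((X⁻¹ : SL2n n F) : BlockMat n F) with hYdef
  have key : ∀ m : ℕ, ∀ i j : Fin n, n - (i : ℕ) ≤ m → j < i → blk Y i j = 0 := by
    intro m
    induction m with
    | zero => intro i j h _; have := i.2; omega
    | succ m ih =>
      intro i j him hij
      have h := blk_mul (X : BlockMat n F) Y i j
      rw [hXY, blk_one, if_neg hij.ne', Finset.sum_eq_single i, hX.1, one_mul] at h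
      · exact h.symm
      · intro k _ hk
        rcases lt_or_gt_of_ne hk with hl | hl
        · rw [hX.2 i k hl, zero_mul]
        · have hl' := Fin.lt_def.1 hl
          rw [ih k j (by omega) (hij.trans hl), mul_zero]
      · simp
  have hlow : ∀ i j, j < i → blk Y i j = 0 := fun i j h => key _ i j le_rfl h
  refine ⟨fun i => ?_, hlow⟩
  have h := blk_mul_self hX.2 hlow i
  rw [hXY, hX.1, one_mul, blk_one, if_pos rfl] at h
  exact h.symm

theorem blk_inv_super {X : SL2n n F} (hX : IsUni (X : BlockMat n F)) (i j : Fin n)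
    (hij : (j : ℕ) = i + 1) :
    blk ((X⁻¹ : SL2n n F) : BlockMat n F) i j = -blk (X : BlockMat n F) i j := by
  have h := blk_mul_super hX hX.inv i j hij
  rw [← Matrix.SpecialLinearGroup.coe_mul, mul_inv_cancel, Matrix.SpecialLinearGroup.coe_one,
    blk_one_super i j hij] at h
  exact (neg_eq_of_add_eq_zero_right h.symm).symm

variable (n F)

/-- The subgroup `H` of `SL_{2n}(F)` of the matrices `Δ(A)`, `A ∈ SL₂(F)`. -/
def H : Subgroup (SL2n n F) where
  carrier := {X | (X : BlockMat n F) ∈ HMat n F}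
  one_mem' := ⟨1, by simp [diagBlock_one]⟩
  mul_mem' := by
    rintro X Y ⟨A, hA⟩ ⟨B, hB⟩
    exact ⟨A * B, by
      rw [Matrix.SpecialLinearGroup.coe_mul, Matrix.SpecialLinearGroup.coe_mul, hA, hB,
        diagBlock_mul]⟩
  inv_mem' := by
    rintro X ⟨A, hA⟩
    refine ⟨A⁻¹, ?_⟩
    have h1 : (X : BlockMat n F) * diagBlock n ((A⁻¹ : Matrix.SpecialLinearGroup (Fin 2) F) :
        Matrix (Fin 2) (Fin 2) F) = 1 := by
      rw [hA, ← diagBlock_mul, ← Matrix.SpecialLinearGroup.coe_mul, mul_inv_cancel,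
        Matrix.SpecialLinearGroup.coe_one, diagBlock_one]
    have h2 : ((X⁻¹ : SL2n n F) : BlockMat n F) * (X : BlockMat n F) = 1 := by
      rw [← Matrix.SpecialLinearGroup.coe_mul, inv_mul_cancel, Matrix.SpecialLinearGroup.coe_one]
    exact left_inv_eq_right_inv h2 h1

/-- The subgroup `M` of `SL_{2n}(F)`. -/
def M : Subgroup (SL2n n F) where
  carrier := {X | (X : BlockMat n F) ∈ MMat n F}
  one_mem' := ⟨isUni_one.1, isUni_one.2, fun i j h => by
    rw [Matrix.SpecialLinearGroup.coe_one, blk_one_super i j h, Matrix.trace_zero]⟩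
  mul_mem' := by
    rintro X Y ⟨hX1, hX2, hX3⟩ ⟨hY1, hY2, hY3⟩
    have hU := IsUni.mul ⟨hX1, hX2⟩ ⟨hY1, hY2⟩
    exact ⟨hU.1, hU.2, fun i j h => by
      rw [Matrix.SpecialLinearGroup.coe_mul, blk_mul_super ⟨hX1, hX2⟩ ⟨hY1, hY2⟩ i j h,
        Matrix.trace_add, hX3 i j h, hY3 i j h, add_zero]⟩
  inv_mem' := by
    rintro X ⟨hX1, hX2, hX3⟩
    have hX : IsUni (X : BlockMat n F) := ⟨hX1, hX2⟩
    exact ⟨hX.inv.1, hX.inv.2, fun i j h => by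
      rw [blk_inv_super hX i j h, Matrix.trace_neg, hX3 i j h, neg_zero]⟩

/-- The subgroup `N` of `SL_{2n}(F)`. -/
def N : Subgroup (SL2n n F) where
  carrier := {X | (X : BlockMat n F) ∈ NMat n F}
  one_mem' := ⟨(M n F).one_mem, fun i j h => ⟨0, by
    rw [Matrix.SpecialLinearGroup.coe_one, blk_one_super i j h, zero_smul]⟩⟩
  mul_mem' := by
    rintro X Y ⟨hX, hX4⟩ ⟨hY, hY4⟩
    refine ⟨(M n F).mul_mem hX hY, fun i j h => ?_⟩
    obtain ⟨a, ha⟩ := hX4 i j h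
    obtain ⟨b, hb⟩ := hY4 i j h
    exact ⟨a + b, by
      rw [Matrix.SpecialLinearGroup.coe_mul,
        blk_mul_super ⟨hX.1, hX.2.1⟩ ⟨hY.1, hY.2.1⟩ i j h, ha, hb, add_smul]⟩
  inv_mem' := by
    rintro X ⟨hX, hX4⟩
    refine ⟨(M n F).inv_mem hX, fun i j h => ?_⟩
    obtain ⟨a, ha⟩ := hX4 i j h
    exact ⟨-a, by rw [blk_inv_super ⟨hX.1, hX.2.1⟩ i j h, ha, neg_smul]⟩

/-- The subgroup `G` of `SL_{2n}(F)` generated by `H` and `M`; that it is the product set `HM` is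
part of the theorem. -/
def G : Subgroup (SL2n n F) := H n F ⊔ M n F

/-- `N` as a subgroup of the group `G` (when `N ≤ G`). -/
def NinG : Subgroup (G n F) := (N n F).subgroupOf (G n F)

end MatrixGroups

/-- The field with four elements. -/
abbrev F4 : Type := GaloisField 2 2

end SubdirectPerfect

/-!
The argument has an abstract half and a matrix half.

For any group `G` and normal subgroup `N`, the commutator of `Δ_A(u)` and `Δ_B(v)` is
`Δ_{A ∪ B}([u, v])` (`commutatorElement_deltaHom`). Let `Γ_k` be generated by the sets
`Δ_A([G, N, …, N])` for `|A| < k` and `Δ_A(γ_{|A|}(N))` for `|A| ≥ k`, with `|A|` copies of `N`.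
Since `|A ∪ B| ≤ |A| + |B|`, the three subgroups lemma gives `[Γ_k, Γ_1] ≤ Γ_{k+1}`
(`commutator_layer_le`, `commutator_gammaGroup_le`), so that `Γ_1 / Γ_{d+1}` is nilpotent of class
at most `d`. The class is not smaller if `[G, N, …, N] < γ_d(N)`: the iterated commutators of the
`Δ_{i}(x_i)`, with `x_i ∈ N`, generate `Δ_{[d]}(γ_d(N))`, and `Γ_{d+1}` meets `Δ_{[d]}(G)` in
`Δ_{[d]}([G, N, …, N])` only (`mem_iterComm_of_deltaHom_univ_mem`). That the ordered product set is
the subgroup `Γ_1` (`deltaProd_eq_deltaSpan`) uses of the short-lex order only that it refines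
inclusion: each final segment of it is then closed under supersets, so that the `Δ_A` from it span
a subgroup which all other factors normalize.

For the matrix groups, filter the block unitriangular matrices by the number of vanishing block
superdiagonals. Scalar superdiagonal blocks are centralized by everything, so `[G, N]` has vanishing
first superdiagonal (`commutator_G_N_le`), and `[G, N, …, N]`, with `d` copies of `N`, has vanishing
first `d` superdiagonals (`map_iterComm_NinG_le`). On the other hand `γ_d(N)` contains the block
transvection with identity block in place `(0, d)`, as a commutator of such block transvections
from the superdiagonal, which lie in `N` because the identity has trace zero in characteristic two
(`elemBlock_one_mem_lowerCentralSeries`). Perfectness of `G` comes from that of `SL₂(F₄)` and from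
writing elements of `M` as products of block transvections (`mem_of_forall_elemBlock_mem`), each of
which is a product of commutators (`elemBlock_mem_commutator_of_trace_eq_zero`,
`elemBlock_mem_commutator`).
-/

open scoped commutatorElement

namespace SubdirectPerfect

/-! ### Commutators of subgroups -/

section Commutators

variable {P : Type*} [Group P]

theorem iSup_le_normalizer {ι κ : Sort*} {X : ι → Subgroup P} {Y : κ → Subgroup P}
    (h : ∀ i j, ⁅X i, Y j⁆ ≤ ⨆ i, X i) :
    ⨆ j, Y j ≤ Subgroup.normalizer (⨆ i, X i : Subgroup P) := by
  refine iSup_le fun j y hy => ?_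
  have key : ∀ z ∈ Y j, ∀ x ∈ ⨆ i, X i, z * x * z⁻¹ ∈ ⨆ i, X i := by
    intro z hz x hx
    refine Subgroup.iSup_induction X (C := fun x => z * x * z⁻¹ ∈ ⨆ i, X i) hx ?_ (by simp) ?_
    · intro i x hx
      have h1 := inv_mem (h i j (Subgroup.commutator_mem_commutator hx hz))
      rw [commutatorElement_inv] at h1
      have h2 := mul_mem h1 (Subgroup.mem_iSup_of_mem i hx)
      rwa [commutatorElement_def, inv_mul_cancel_right] at h2
    · intro a b ha hb
      have := mul_mem ha hb
      rwa [show z * a * z⁻¹ * (z * b * z⁻¹) = z * (a * b) * z⁻¹ by group] at this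
  rw [Subgroup.mem_normalizer_iff]
  refine fun x => ⟨key y hy x, fun hx => ?_⟩
  have := key y⁻¹ (inv_mem hy) _ hx
  rwa [show y⁻¹ * (y * x * y⁻¹) * y⁻¹⁻¹ = x by group] at this

theorem commutator_iSup_le {ι κ : Sort*} {X : ι → Subgroup P} {Y : κ → Subgroup P}
    {Z : Subgroup P} (h : ∀ i j, ⁅X i, Y j⁆ ≤ Z) (hX : ⨆ i, X i ≤ Subgroup.normalizer Z)
    (hY : ⨆ j, Y j ≤ Subgroup.normalizer Z) : ⁅⨆ i, X i, ⨆ j, Y j⁆ ≤ Z := by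
  rw [Subgroup.commutator_le]
  intro x hx y hy
  refine Subgroup.iSup_induction' X (C := fun x _ => ⁅x, y⁆ ∈ Z) ?_ (by simp) ?_ hx
  · intro i x hx
    refine Subgroup.iSup_induction' Y (C := fun y _ => ⁅x, y⁆ ∈ Z) ?_ (by simp) ?_ hy
    · exact fun j y hy => h i j (Subgroup.commutator_mem_commutator hx hy)
    · intro a b ha _ h1 h2
      rw [commutatorElement_mul_right_eq_mul_conj, mul_assoc, mul_assoc, ← mul_assoc a]
      exact mul_mem h1 ((Subgroup.mem_normalizer_iff.1 (hY ha) _).1 h2)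
  · intro a b ha _ h1 h2
    rw [commutatorElement_mul_left_eq_conj_mul]
    exact mul_mem ((Subgroup.mem_normalizer_iff.1 (hX ha) _).1 h2) h1

/-- The three subgroups lemma, relative to a normal subgroup. -/
theorem commutator_commutator_le_of_rotate {A B C Z : Subgroup P} [Z.Normal]
    (h1 : ⁅⁅B, C⁆, A⁆ ≤ Z) (h2 : ⁅⁅C, A⁆, B⁆ ≤ Z) : ⁅⁅A, B⁆, C⁆ ≤ Z := by
  have hmap : ∀ X : Subgroup P, X ≤ Z ↔ X.map (QuotientGroup.mk' Z) = ⊥ := fun X => by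
    rw [Subgroup.map_eq_bot_iff, QuotientGroup.ker_mk']
  rw [hmap] at *
  simp only [Subgroup.map_commutator] at *
  exact Subgroup.commutator_commutator_eq_bot_of_rotate h1 h2

/-- If `X` is a descending chain of normal subgroups on which `N` acts with `[X_k, N] ≤ X_{k+1}`,
then `γ_{b+1}(N)` lowers the index by `b + 1`. -/
theorem commutator_lowerCentralSeries_le {X : ℕ → Subgroup P} {N : Subgroup P}
    (hX : ∀ k, (X k).Normal) (h : ∀ k, ⁅X k, N⁆ ≤ X (k + 1)) (a b : ℕ) :
    ⁅X a, N.lowerCentralSeries b⁆ ≤ X (a + b + 1) := by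
  induction b generalizing a with
  | zero => exact h a
  | succ b ih =>
    have := hX (a + (b + 1) + 1)
    rw [Subgroup.lowerCentralSeries_succ, Subgroup.commutator_comm]
    refine commutator_commutator_le_of_rotate ?_ ?_
    · rw [Subgroup.commutator_comm N]
      refine (Subgroup.commutator_mono (h a) le_rfl).trans ((ih (a + 1)).trans (le_of_eq ?_))
      congr 1; omega
    · exact (Subgroup.commutator_mono (ih a) le_rfl).trans (h (a + b + 1))

variable (N : Subgroup P)

/-- The subgroups from which `Γ_k(G, N)` is assembled: `Δ_A` is applied to the one with index
`c = |A|`. -/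
def layer (k c : ℕ) : Subgroup P := if c < k then iterComm N c else gammaSub c N

theorem layer_of_lt {k c : ℕ} (h : c < k) : layer N k c = iterComm N c := if_pos h

theorem layer_of_le {k c : ℕ} (h : k ≤ c) : layer N k c = gammaSub c N := if_neg (not_lt.2 h)

variable [N.Normal]

instance iterComm_normal (k : ℕ) : (iterComm N k).Normal := by
  induction k with
  | zero => exact inferInstanceAs (⊤ : Subgroup P).Normal
  | succ k ih => exact Subgroup.commutator_normal _ _

theorem iterComm_antitone : Antitone (iterComm N) :=
  antitone_nat_of_succ_le fun k => Subgroup.commutator_le_left (iterComm N k) N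

theorem iterComm_le_gammaSub (k : ℕ) (hk : 1 ≤ k) : iterComm N k ≤ gammaSub k N := by
  induction k, hk using Nat.le_induction with
  | base => exact Subgroup.commutator_le_right ⊤ N
  | succ k hk ih =>
    obtain ⟨k, rfl⟩ := Nat.exists_eq_add_of_le' hk
    exact Subgroup.commutator_mono ih le_rfl

instance layer_normal (k c : ℕ) : (layer N k c).Normal := by
  unfold layer gammaSub
  split_ifs <;> infer_instance

theorem layer_succ_le {k : ℕ} (hk : 1 ≤ k) (c : ℕ) : layer N (k + 1) c ≤ layer N k c := by
  rcases lt_trichotomy c k with h | rfl | h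
  · rw [layer_of_lt N h, layer_of_lt N (by omega)]
  · rw [layer_of_lt N c.lt_succ_self, layer_of_le N le_rfl]
    exact iterComm_le_gammaSub N c hk
  · rw [layer_of_le N h, layer_of_le N h.le]

/-- Commutators of a component of `Γ_k` with one of `Γ_1` are components of `Γ_{k+1}`. Here `a`, `b`, `c` are the sizes of `A`, `B` and `A ∪ B`. -/
theorem commutator_layer_le {k a b c : ℕ} (hk : 1 ≤ k) (ha : a ≤ c) (hb : b ≤ c)
    (hc : c ≤ a + b) : ⁅layer N k a, layer N 1 b⁆ ≤ layer N (k + 1) c := by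
  -- `[[G, N, …, N], γ_b(N)] ≤ [G, N, …, N]`, with `i`, resp. `i + b` copies of `N`
  have hG : ∀ i, ⁅iterComm N i, layer N 1 b⁆ ≤ iterComm N (i + b) := by
    intro i
    rcases Nat.eq_zero_or_pos b with rfl | hb
    · exact Subgroup.commutator_le_left _ _
    · rw [layer_of_le N hb]
      refine (commutator_lowerCentralSeries_le (iterComm_normal N) (fun _ => le_rfl) i
        (b - 1)).trans (le_of_eq ?_)
      congr 1; omega
  rcases lt_or_ge a k with h | h
  · rw [layer_of_lt N h]
    refine (hG a).trans ((iterComm_antitone N hc).trans ?_)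
    rcases lt_or_ge k c with h' | h'
    · rw [layer_of_le N h']
      exact iterComm_le_gammaSub N c (by omega)
    · rw [layer_of_lt N (by omega)]
  · rw [layer_of_le N h]
    rcases lt_or_ge k c with h' | h'
    · rw [layer_of_le N h']
      rcases Nat.eq_zero_or_pos b with rfl | hb'
      · obtain rfl : a = c := by omega
        have : (gammaSub a N).Normal := Subgroup.lowerCentralSeries_normal N _
        exact Subgroup.commutator_le_left _ _
      · rw [layer_of_le N hb']
        refine (commutator_lowerCentralSeries_le (fun i => Subgroup.lowerCentralSeries_normal N i)
          (fun _ => le_rfl) (a - 1) (b - 1)).trans ?_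
        exact N.lowerCentralSeries_antitone (by omega)
    · -- here `a = c = k`, and it suffices that `[G, γ_k(N)] ≤ [G, N, …, N]`
      obtain rfl : a = c := by omega
      rw [layer_of_lt N (k := k + 1) (by omega), Subgroup.commutator_comm]
      refine (Subgroup.commutator_mono (le_top : _ ≤ iterComm N 0) le_rfl).trans ?_
      refine (commutator_lowerCentralSeries_le (iterComm_normal N) (fun _ => le_rfl) 0
        (a - 1)).trans (le_of_eq ?_)
      congr 1; omega

end Commutators

/-! ### The subgroups generated by the elements `Δ_A(u)` -/

section Delta

variable {P : Type*} [Group P] {d : ℕ}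

/-- `Δ_A` as a group homomorphism. -/
noncomputable def deltaHom (A : Finset (Fin d)) : P →* (Finset (Fin d) → P) where
  toFun := Delta A
  map_one' := by ext B; simp [Delta]
  map_mul' u v := by ext B; by_cases h : A ⊆ B <;> simp [Delta, h]

theorem deltaHom_apply (A B : Finset (Fin d)) (u : P) [Decidable (A ⊆ B)] :
    deltaHom A u B = if A ⊆ B then u else 1 := by
  simp [deltaHom, Delta]

theorem commutatorElement_deltaHom (A B : Finset (Fin d)) (u v : P) :
    ⁅deltaHom A u, deltaHom B v⁆ = deltaHom (A ∪ B) ⁅u, v⁆ := by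
  classical
  ext C
  rw [commutatorElement_def]
  simp only [Pi.mul_apply, Pi.inv_apply, deltaHom_apply, Finset.union_subset_iff]
  by_cases hA : A ⊆ C <;> by_cases hB : B ⊆ C <;> simp [hA, hB, commutatorElement_def]

/-- The subgroup of `P ^ 𝒫([d])` generated by the sets `Δ_A(X_A)`. -/
noncomputable def deltaSpan (X : Finset (Fin d) → Subgroup P) : Subgroup (Finset (Fin d) → P) :=
  ⨆ A, (X A).map (deltaHom A)

theorem map_deltaHom_le_deltaSpan (X : Finset (Fin d) → Subgroup P) (A : Finset (Fin d)) :
    (X A).map (deltaHom A) ≤ deltaSpan X :=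
  le_iSup (fun A => (X A).map (deltaHom A)) A

theorem deltaSpan_mono {X Y : Finset (Fin d) → Subgroup P} (h : X ≤ Y) :
    deltaSpan X ≤ deltaSpan Y :=
  iSup_mono fun A => Subgroup.map_mono (h A)

theorem commutator_map_deltaHom (A B : Finset (Fin d)) (X Y : Subgroup P) :
    ⁅X.map (deltaHom A), Y.map (deltaHom B)⁆ ≤ (⁅X, Y⁆ : Subgroup P).map (deltaHom (A ∪ B)) := by
  rw [Subgroup.commutator_le]
  rintro _ ⟨u, hu, rfl⟩ _ ⟨v, hv, rfl⟩
  rw [commutatorElement_deltaHom]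
  exact Subgroup.mem_map_of_mem _ (Subgroup.commutator_mem_commutator hu hv)

theorem commutator_map_deltaHom_le {X Y Z : Finset (Fin d) → Subgroup P}
    (h : ∀ A B, ⁅X A, Y B⁆ ≤ Z (A ∪ B)) (A B : Finset (Fin d)) :
    ⁅(X A).map (deltaHom A), (Y B).map (deltaHom B)⁆ ≤ deltaSpan Z :=
  (commutator_map_deltaHom A B _ _).trans
    ((Subgroup.map_mono (h A B)).trans (map_deltaHom_le_deltaSpan Z _))

theorem deltaSpan_le_normalizer {X Y : Finset (Fin d) → Subgroup P}
    (h : ∀ A B, ⁅X A, Y B⁆ ≤ X (A ∪ B)) :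
    deltaSpan Y ≤ Subgroup.normalizer (deltaSpan X : Subgroup _) :=
  iSup_le_normalizer (commutator_map_deltaHom_le h)

/-- The product set of the `Δ_A(X_A)`, for `A` running through the list `l`. -/
noncomputable def deltaProd (X : Finset (Fin d) → Subgroup P) (l : List (Finset (Fin d))) :
    Set (Finset (Fin d) → P) :=
  (l.map fun A => Delta A '' (X A : Set P)).prod

open scoped Classical in
/-- If the list `l` is closed under supersets, and no member of it contains a later one, then
multiplying the sets `Δ_A(X_A)` in the order of `l` gives the subgroup that they generate. -/
theorem deltaProd_eq_deltaSpan {X : Finset (Fin d) → Subgroup P}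
    (h : ∀ A B, ⁅X A, X B⁆ ≤ X (A ∪ B)) (l : List (Finset (Fin d)))
    (hl : l.Pairwise fun A B => ¬ B ⊆ A) (hup : ∀ A ∈ l, ∀ C, A ⊆ C → C ∈ l) :
    deltaProd X l = (deltaSpan fun A => if A ∈ l then X A else ⊥ : Subgroup _) := by
  induction l with
  | nil => simpa [deltaProd, deltaSpan] using Set.singleton_one.symm
  | cons A l ih =>
    rw [List.pairwise_cons] at hl
    have hup' : ∀ B ∈ l, ∀ C, B ⊆ C → C ∈ l := by
      intro B hB C hC
      rcases List.mem_cons.1 (hup B (List.mem_cons_of_mem _ hB) C hC) with rfl | h'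
      · exact absurd hC (hl.1 B hB)
      · exact h'
    have hn : (X A).map (deltaHom A) ≤
        Subgroup.normalizer (deltaSpan fun A => if A ∈ l then X A else ⊥ : Subgroup _) := by
      refine (map_deltaHom_le_deltaSpan X A).trans (deltaSpan_le_normalizer fun B C => ?_)
      by_cases hB : B ∈ l
      · rw [if_pos hB, if_pos (hup' B hB _ Finset.subset_union_left)]
        exact h B C
      · rw [if_neg hB, Subgroup.commutator_bot_left]
        exact bot_le
    have hprod : deltaProd X (A :: l) = ((X A).map (deltaHom A) : Set _) * deltaProd X l := by
      rw [deltaProd, List.map_cons, List.prod_cons]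
      rfl
    rw [hprod, ih hl.2 hup', ← Subgroup.coe_mul_of_left_le_normalizer_right _ _ hn,
      SetLike.coe_set_eq]
    refine le_antisymm (sup_le ?_ (deltaSpan_mono fun B => ?_)) (iSup_le fun B => ?_)
    · refine le_trans (le_of_eq ?_) (map_deltaHom_le_deltaSpan _ A)
      rw [if_pos List.mem_cons_self]
    · by_cases hB : B ∈ l
      · simp [hB]
      · simp [hB]
    · dsimp only
      by_cases hB : B ∈ A :: l
      · rw [if_pos hB]
        rcases List.mem_cons.1 hB with rfl | hB
        · exact le_sup_left
        · refine le_sup_of_le_right (le_trans (le_of_eq ?_) (map_deltaHom_le_deltaSpan _ B))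
          rw [if_pos hB]
      · rw [if_neg hB, Subgroup.map_bot]
        exact bot_le

theorem subsetList_pairwise (d : ℕ) : (subsetList d).Pairwise fun A B => ¬ B ⊆ A := by
  classical
  have h1 : (subsetList d).Pairwise ShortLexLE := Finset.pairwise_sort _ _
  have h2 : (subsetList d).Nodup := Finset.sort_nodup _ _
  refine h1.imp₂ ?_ h2
  rintro A B (h | h | h) hne hBA
  · exact hne h
  · exact absurd (Finset.card_le_card hBA) (not_le.2 h)
  · exact hne (Finset.eq_of_subset_of_card_le hBA h.1.le).symm

theorem mem_subsetList (A : Finset (Fin d)) : A ∈ subsetList d := by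
  simp [subsetList]

theorem deltaProd_subsetList {X : Finset (Fin d) → Subgroup P}
    (h : ∀ A B, ⁅X A, X B⁆ ≤ X (A ∪ B)) :
    deltaProd X (subsetList d) = (deltaSpan X : Subgroup _) := by
  rw [deltaProd_eq_deltaSpan h _ (subsetList_pairwise d) fun _ _ C _ => mem_subsetList C]
  simp [mem_subsetList]

/-- An element of the ordered product whose components are trivial except for the last one comes
from the last factor: the components force the factors to be trivial one after the other. -/
theorem apply_univ_mem_of_mem_deltaProd {X : Finset (Fin d) → Subgroup P}
    {l : List (Finset (Fin d))} (hl : l.Pairwise fun A B => ¬ B ⊆ A) {x : Finset (Fin d) → P}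
    (hx : x ∈ deltaProd X l) (h1 : ∀ B, B ≠ Finset.univ → x B = 1) :
    x Finset.univ ∈ X Finset.univ := by
  classical
  have hvanish : ∀ (l : List (Finset (Fin d))) (A : Finset (Fin d)), (∀ B ∈ l, ¬ B ⊆ A) →
      ∀ y ∈ deltaProd X l, y A = 1 := by
    intro l A hA
    induction l with
    | nil =>
      rintro y (rfl : y = 1)
      rfl
    | cons B l ih =>
      rintro _ ⟨_, ⟨u, -, rfl⟩, z, hz, rfl⟩
      have := ih (fun C hC => hA C (List.mem_cons_of_mem _ hC)) z hz
      simp [Delta, this, hA B List.mem_cons_self]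
  induction l generalizing x with
  | nil =>
    obtain rfl : x = 1 := hx
    exact one_mem _
  | cons A l ih =>
    rw [List.pairwise_cons] at hl
    obtain ⟨_, ⟨u, hu, rfl⟩, y, hy, hxy⟩ := hx
    change Delta A u * y = x at hxy
    subst hxy
    by_cases hA : A = Finset.univ
    · subst hA
      have hy' := ih hl.2 hy fun B hB => by
        have := h1 B hB
        simpa [Delta, Finset.univ_subset_iff, hB] using this
      have := mul_mem hu hy'
      simpa [Delta] using this
    · have hu1 : u = 1 := by
        have := h1 A hA
        simpa [Delta, hvanish l A hl.1 y hy] using this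
      have hD : Delta A u * y = y := by
        rw [hu1]
        ext B
        simp [Delta]
      rw [hD] at h1 ⊢
      exact ih hl.2 hy h1

end Delta

/-! ### The nilpotent quotient of `Γ_1` -/

section Quotient

variable {P : Type*} [Group P] (N : Subgroup P) (d : ℕ)

/-- `Γ_k(G, N)` as a subgroup, for `k ≥ 1`. -/
noncomputable def gammaGroup (k : ℕ) : Subgroup (Finset (Fin d) → P) :=
  deltaSpan fun A => layer N k A.card

theorem isSubdirect_gammaGroup_one : IsSubdirect (gammaGroup N d 1) := by
  classical
  intro B
  refine eq_top_iff.2 fun u _ => ⟨deltaHom ∅ u, ?_, ?_⟩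
  · refine map_deltaHom_le_deltaSpan _ ∅ (Subgroup.mem_map_of_mem _ ?_)
    exact Subgroup.mem_top u
  · simp [deltaHom_apply]

variable {d}

/-- `Δ_{a, b, …}([x, y, …])` is the iterated commutator of `Δ_{a}(x)`, `Δ_{b}(y)`, …, which lie in
`Γ_1`. -/
theorem map_deltaHom_lowerCentralSeries_le (e : ℕ) (A : Finset (Fin d)) (hA : A.card = e + 1) :
    (N.lowerCentralSeries e).map (deltaHom A) ≤ (gammaGroup N d 1).lowerCentralSeries e := by
  have hsingle : ∀ A : Finset (Fin d), A.card = 1 → N.map (deltaHom A) ≤ gammaGroup N d 1 := by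
    intro A hA
    refine le_trans (le_of_eq ?_) (map_deltaHom_le_deltaSpan _ A)
    rw [hA]
    rfl
  induction e generalizing A with
  | zero => exact hsingle A hA
  | succ e ih =>
    obtain ⟨a, B, ha, rfl, hB⟩ := Finset.card_eq_succ.1 hA
    rw [Subgroup.lowerCentralSeries_succ, Subgroup.lowerCentralSeries_succ,
      Subgroup.map_le_iff_le_comap, Subgroup.commutator_le]
    intro x hx y hy
    rw [Subgroup.mem_comap, Finset.insert_eq, Finset.union_comm, ← commutatorElement_deltaHom]
    exact Subgroup.commutator_mem_commutator (ih B hB (Subgroup.mem_map_of_mem _ hx))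
      (hsingle _ (Finset.card_singleton a) (Subgroup.mem_map_of_mem _ hy))

variable [N.Normal]

theorem commutator_layer_card_le {k : ℕ} (hk : 1 ≤ k) (A B : Finset (Fin d)) :
    ⁅layer N k A.card, layer N 1 B.card⁆ ≤ layer N (k + 1) (A ∪ B).card :=
  commutator_layer_le N hk (Finset.card_le_card Finset.subset_union_left)
    (Finset.card_le_card Finset.subset_union_right) (Finset.card_union_le A B)

variable (d)

theorem gammaGroup_succ_le {k : ℕ} (hk : 1 ≤ k) : gammaGroup N d (k + 1) ≤ gammaGroup N d k :=
  deltaSpan_mono fun _ => layer_succ_le N hk _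

theorem gammaGroup_le_one {k : ℕ} (hk : 1 ≤ k) : gammaGroup N d k ≤ gammaGroup N d 1 := by
  induction k, hk using Nat.le_induction with
  | base => exact le_rfl
  | succ k hk ih => exact (gammaGroup_succ_le N d hk).trans ih

theorem gammaGroup_one_le_normalizer {k : ℕ} (hk : 1 ≤ k) :
    gammaGroup N d 1 ≤ Subgroup.normalizer (gammaGroup N d k : Subgroup _) :=
  deltaSpan_le_normalizer fun A B => (commutator_layer_card_le N hk A B).trans
    (layer_succ_le N hk _)

theorem commutator_gammaGroup_le {k : ℕ} (hk : 1 ≤ k) :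
    ⁅gammaGroup N d k, gammaGroup N d 1⁆ ≤ gammaGroup N d (k + 1) :=
  have hn := gammaGroup_one_le_normalizer N d (Nat.le_add_left 1 k)
  commutator_iSup_le (commutator_map_deltaHom_le (commutator_layer_card_le N hk))
    ((gammaGroup_le_one N d hk).trans hn) hn

theorem gammaSet_one_eq : GammaSet d 1 N = (gammaGroup N d 1 : Set _) :=
  deltaProd_subsetList fun A B =>
    (commutator_layer_card_le N le_rfl A B).trans (layer_succ_le N le_rfl _)

theorem lowerCentralSeries_gammaGroup_le (k : ℕ) :
    (gammaGroup N d 1).lowerCentralSeries k ≤ gammaGroup N d (k + 1) := by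
  induction k with
  | zero => exact le_rfl
  | succ k ih =>
    exact (Subgroup.commutator_mono ih le_rfl).trans
      (commutator_gammaGroup_le N d (Nat.le_add_left 1 k))

variable {d}

/-- The subgroups `Γ_{d+1}` and `Δ_{[d]}(G)` meet in `Δ_{[d]}([G, N, …, N])`. -/
theorem mem_iterComm_of_deltaHom_univ_mem {u : P}
    (hu : deltaHom (Finset.univ : Finset (Fin d)) u ∈ gammaGroup N d (d + 1)) :
    u ∈ iterComm N d := by
  classical
  have hX : ∀ A B : Finset (Fin d), ⁅layer N (d + 1) A.card, layer N (d + 1) B.card⁆ ≤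
      layer N (d + 1) (A ∪ B).card := by
    have hmono : ∀ k, 1 ≤ k → ∀ c, layer N k c ≤ layer N 1 c := by
      intro k hk c
      induction k, hk using Nat.le_induction with
      | base => exact le_rfl
      | succ k hk ih => exact (layer_succ_le N hk c).trans ih
    exact fun A B => (Subgroup.commutator_mono le_rfl (hmono _ (by omega) _)).trans
      ((commutator_layer_card_le N (by omega) A B).trans (layer_succ_le N (by omega) _))
  have hu' : deltaHom Finset.univ u ∈ deltaProd (fun A : Finset (Fin d) => layer N (d + 1) A.card)
      (subsetList d) := by
    rw [deltaProd_subsetList hX]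
    exact hu
  have h := apply_univ_mem_of_mem_deltaProd (subsetList_pairwise d) hu' fun B hB => by
    rw [deltaHom_apply, if_neg (by rwa [Finset.univ_subset_iff])]
  rwa [deltaHom_apply, if_pos (Finset.Subset.refl _), Finset.card_univ, Fintype.card_fin,
    layer_of_lt N (Nat.lt_succ_self d)] at h

/-- The quotient `Γ_1 / Γ_{d+1}` has nilpotency class `d`, unless `d ≥ 1` and
`[G, N, …, N] = γ_d(N)`. -/
theorem hasNilpotentQuotientOfClass_gammaGroup_one
    (h : 1 ≤ d → iterComm N d < gammaSub d N) :
    HasNilpotentQuotientOfClass (gammaGroup N d 1) d := by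
  set S := gammaGroup N d 1 with hS
  let K : Subgroup S := (gammaGroup N d (d + 1)).subgroupOf S
  have hK : K.Normal :=
    Subgroup.normal_subgroupOf_of_le_normalizer (gammaGroup_one_le_normalizer N d (by omega))
  have key : ∀ e, (⊤ : Subgroup (S ⧸ K)).lowerCentralSeries e = ⊥ ↔
      S.lowerCentralSeries e ≤ gammaGroup N d (d + 1) := by
    intro e
    rw [← Subgroup.map_top_of_surjective _ (QuotientGroup.mk'_surjective K),
      ← Subgroup.map_lowerCentralSeries, Subgroup.map_eq_bot_iff, QuotientGroup.ker_mk',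
      ← Subgroup.top_subtype_lowerCentralSeries S e, Subgroup.map_le_iff_le_comap]
    rfl
  have hbot := (key d).2 (lowerCentralSeries_gammaGroup_le N d d)
  have hnil : Group.IsNilpotent (S ⧸ K) := Subgroup.nilpotent_iff_lowerCentralSeries.2 ⟨d, hbot⟩
  refine ⟨K, hK, hnil, le_antisymm
    (Subgroup.lowerCentralSeries_eq_bot_iff_nilpotencyClass_le.1 hbot) ?_⟩
  by_contra! hlt
  obtain ⟨e, rfl⟩ : ∃ e, d = e + 1 := Nat.exists_eq_add_of_le' (by omega)
  have hle := (key e).1 (Subgroup.lowerCentralSeries_eq_bot_iff_nilpotencyClass_le.2 (by omega))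
  refine (h (by omega)).not_ge fun u hu => mem_iterComm_of_deltaHom_univ_mem N (hle ?_)
  exact map_deltaHom_lowerCentralSeries_le N e Finset.univ (by simp)
    (Subgroup.mem_map_of_mem _ hu)

end Quotient

/-! ### Elementary block matrices -/

section Elementary

variable {n : ℕ} {F : Type*}

theorem blk_ext {X Y : BlockMat n F} (h : ∀ i j, blk X i j = blk Y i j) : X = Y := by
  ext ⟨i, a⟩ ⟨j, b⟩
  exact congrFun (congrFun (h i j) a) b

variable [Field F]

theorem blk_add (X Y : BlockMat n F) (i j : Fin n) : blk (X + Y) i j = blk X i j + blk Y i j := rfl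

theorem blk_sub (X Y : BlockMat n F) (i j : Fin n) : blk (X - Y) i j = blk X i j - blk Y i j := rfl

theorem blk_diagBlock (A : Matrix (Fin 2) (Fin 2) F) (i j : Fin n) :
    blk (diagBlock n A) i j = if i = j then A else 0 := by
  ext a b
  by_cases h : i = j <;> simp [blk, diagBlock, h]

theorem blk_diagBlock_mul (A : Matrix (Fin 2) (Fin 2) F) (X : BlockMat n F) (i j : Fin n) :
    blk (diagBlock n A * X) i j = A * blk X i j := by
  simp [blk_mul, blk_diagBlock, ite_mul]

theorem blk_mul_diagBlock (A : Matrix (Fin 2) (Fin 2) F) (X : BlockMat n F) (i j : Fin n) :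
    blk (X * diagBlock n A) i j = blk X i j * A := by
  simp [blk_mul, blk_diagBlock, mul_ite]

theorem det_diagBlock (A : Matrix (Fin 2) (Fin 2) F) : (diagBlock n A).det = A.det ^ n := by
  have h : diagBlock n A =
      Matrix.kroneckerMap (fun x y => x * y) (1 : Matrix (Fin n) (Fin n) F) A := by
    ext ⟨i, a⟩ ⟨j, b⟩
    by_cases h : i = j <;> simp [diagBlock, h]
  rw [h, Matrix.det_kronecker]
  simp

theorem IsUni.det_eq_one {X : BlockMat n F} (hX : IsUni X) : X.det = 1 := by
  have ht : Matrix.BlockTriangular X Prod.fst := fun p q h =>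
    congrFun (congrFun (hX.2 p.1 q.1 h) p.2) q.2
  rw [ht.det_fintype]
  refine Finset.prod_eq_one fun i _ => ?_
  have h1 : X.toSquareBlock Prod.fst i = 1 := by
    ext ⟨⟨j, a⟩, rfl⟩ ⟨⟨k, b⟩, hk⟩
    dsimp only at hk
    subst hk
    have := congrFun (congrFun (hX.1 k) a) b
    simpa [blk, Matrix.toSquareBlock_def, Matrix.one_apply] using this
  rw [h1, Matrix.det_one]

/-- The block matrix with `(i, j)` block `A` and all other blocks zero. -/
def singleBlock (i j : Fin n) (A : Matrix (Fin 2) (Fin 2) F) : BlockMat n F :=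
  Matrix.of fun p q => if p.1 = i ∧ q.1 = j then A p.2 q.2 else 0

theorem blk_singleBlock (i j k l : Fin n) (A : Matrix (Fin 2) (Fin 2) F) :
    blk (singleBlock i j A) k l = if k = i ∧ l = j then A else 0 := by
  ext a b
  by_cases h : k = i ∧ l = j <;> simp [blk, singleBlock, h]

theorem blk_singleBlock_mul (i j k l : Fin n) (A : Matrix (Fin 2) (Fin 2) F) (X : BlockMat n F) :
    blk (singleBlock i j A * X) k l = if k = i then A * blk X j l else 0 := by
  simp only [blk_mul, blk_singleBlock]
  by_cases h : k = i <;> simp [h, ite_mul]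

theorem singleBlock_add (i j : Fin n) (A B : Matrix (Fin 2) (Fin 2) F) :
    singleBlock i j (A + B) = singleBlock i j A + singleBlock i j B := by
  refine blk_ext fun k l => ?_
  rw [blk_add]
  simp only [blk_singleBlock]
  split_ifs <;> simp

theorem singleBlock_mul_same (i j l : Fin n) (A B : Matrix (Fin 2) (Fin 2) F) :
    singleBlock i j A * singleBlock j l B = singleBlock i l (A * B) := by
  refine blk_ext fun k m => ?_
  simp only [blk_singleBlock_mul, blk_singleBlock]
  by_cases h : k = i <;> by_cases h' : m = l <;> simp [h, h']

theorem singleBlock_mul_of_ne {i j k l : Fin n} (h : j ≠ k) (A B : Matrix (Fin 2) (Fin 2) F) :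
    singleBlock i j A * singleBlock k l B = 0 := by
  refine blk_ext fun p q => ?_
  simp only [blk_singleBlock_mul, blk_singleBlock]
  simp only [h, false_and, if_false, mul_zero, ite_self]
  rfl

theorem isUni_one_add_singleBlock {i j : Fin n} (h : i < j) (A : Matrix (Fin 2) (Fin 2) F) :
    IsUni (1 + singleBlock i j A) := by
  refine ⟨fun k => ?_, fun k l hkl => ?_⟩
  · rw [blk_add, blk_one, blk_singleBlock, if_pos rfl, if_neg, add_zero]
    rintro ⟨rfl, rfl⟩
    exact h.ne rfl
  · rw [blk_add, blk_one, blk_singleBlock, if_neg hkl.ne', if_neg, add_zero]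
    rintro ⟨rfl, rfl⟩
    exact lt_asymm h hkl

/-- The block transvection with `(i, j)` block `A`, for `i < j`. -/
def elemBlock {i j : Fin n} (h : i < j) (A : Matrix (Fin 2) (Fin 2) F) : SL2n n F :=
  ⟨1 + singleBlock i j A, (isUni_one_add_singleBlock h A).det_eq_one⟩

theorem coe_elemBlock {i j : Fin n} (h : i < j) (A : Matrix (Fin 2) (Fin 2) F) :
    (elemBlock h A : BlockMat n F) = 1 + singleBlock i j A := rfl

theorem blk_elemBlock_self {i j : Fin n} (h : i < j) (A : Matrix (Fin 2) (Fin 2) F) :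
    blk (elemBlock h A : BlockMat n F) i j = A := by
  rw [coe_elemBlock, blk_add, blk_one, blk_singleBlock, if_neg h.ne, if_pos ⟨rfl, rfl⟩, zero_add]

theorem elemBlock_add {i j : Fin n} (h : i < j) (A B : Matrix (Fin 2) (Fin 2) F) :
    elemBlock h (A + B) = elemBlock h A * elemBlock h B := by
  apply Subtype.ext
  rw [Matrix.SpecialLinearGroup.coe_mul]
  simp only [coe_elemBlock, singleBlock_add, mul_add, add_mul, mul_one, one_mul,
    singleBlock_mul_of_ne h.ne', add_zero]
  abel

theorem elemBlock_zero {i j : Fin n} (h : i < j) :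
    elemBlock h (0 : Matrix (Fin 2) (Fin 2) F) = 1 := by
  have := elemBlock_add h (0 : Matrix (Fin 2) (Fin 2) F) 0
  rw [add_zero] at this
  exact left_eq_mul.1 this

theorem elemBlock_neg {i j : Fin n} (h : i < j) (A : Matrix (Fin 2) (Fin 2) F) :
    elemBlock h (-A) = (elemBlock h A)⁻¹ := by
  rw [eq_inv_iff_mul_eq_one, ← elemBlock_add, neg_add_cancel, elemBlock_zero]

theorem commutatorElement_elemBlock {i j k : Fin n} (h : i < j) (h' : j < k)
    (A B : Matrix (Fin 2) (Fin 2) F) :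
    ⁅elemBlock h A, elemBlock h' B⁆ = elemBlock (h.trans h') (A * B) := by
  rw [commutatorElement_def, mul_inv_eq_iff_eq_mul, mul_inv_eq_iff_eq_mul]
  apply Subtype.ext
  simp only [Matrix.SpecialLinearGroup.coe_mul, coe_elemBlock, mul_add, add_mul, mul_one, one_mul,
    singleBlock_mul_same, singleBlock_mul_of_ne (h.trans h').ne', singleBlock_mul_of_ne h'.ne',
    add_zero]
  abel

variable (n) in
/-- `A ↦ Δ(A)` as a group homomorphism from `SL₂` to `SL_{2n}`. -/
def diagHom : Matrix.SpecialLinearGroup (Fin 2) F →* SL2n n F where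
  toFun A := ⟨diagBlock n A, by rw [det_diagBlock, A.2, one_pow]⟩
  map_one' := Subtype.ext diagBlock_one
  map_mul' A B := Subtype.ext (diagBlock_mul _ _)

theorem coe_diagHom (A : Matrix.SpecialLinearGroup (Fin 2) F) :
    (diagHom n A : BlockMat n F) = diagBlock n (A : Matrix (Fin 2) (Fin 2) F) := rfl

variable (n F) in
theorem H_eq_range :
    H n F = (diagHom n : Matrix.SpecialLinearGroup (Fin 2) F →* SL2n n F).range := by
  ext X
  exact ⟨fun ⟨A, hA⟩ => ⟨A, Subtype.ext hA.symm⟩, fun ⟨A, hA⟩ => ⟨A, congrArg Subtype.val hA.symm⟩⟩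

theorem diagHom_mem_H (A : Matrix.SpecialLinearGroup (Fin 2) F) : diagHom n A ∈ H n F := ⟨A, rfl⟩

theorem commutatorElement_diagHom_elemBlock {i j : Fin n} (h : i < j)
    (A : Matrix.SpecialLinearGroup (Fin 2) F) (B : Matrix (Fin 2) (Fin 2) F) :
    ⁅diagHom n A, elemBlock h B⁆ =
      elemBlock h ((A : Matrix (Fin 2) (Fin 2) F) * B *
        ((A⁻¹ : Matrix.SpecialLinearGroup (Fin 2) F) : Matrix (Fin 2) (Fin 2) F) - B) := by
  rw [sub_eq_add_neg, elemBlock_add, elemBlock_neg, commutatorElement_def]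
  congr 1
  rw [mul_inv_eq_iff_eq_mul]
  apply Subtype.ext
  refine blk_ext fun k l => ?_
  have hA : ((A⁻¹ : Matrix.SpecialLinearGroup (Fin 2) F) : Matrix (Fin 2) (Fin 2) F) * A = 1 := by
    rw [← Matrix.SpecialLinearGroup.coe_mul, inv_mul_cancel, Matrix.SpecialLinearGroup.coe_one]
  rw [Matrix.SpecialLinearGroup.coe_mul, Matrix.SpecialLinearGroup.coe_mul, coe_diagHom,
    blk_diagBlock_mul, blk_mul_diagBlock]
  simp only [coe_elemBlock, blk_add, blk_one, blk_singleBlock]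
  by_cases hkl : k = i ∧ l = j
  · obtain ⟨rfl, rfl⟩ := hkl
    rw [if_neg h.ne, if_pos ⟨rfl, rfl⟩, if_pos ⟨rfl, rfl⟩, zero_add, zero_add, mul_assoc _ _ A.1,
      hA, mul_one]
  · rw [if_neg hkl, if_neg hkl, add_zero]
    split_ifs <;> simp

/-- A block unitriangular matrix is a product of the block transvections read off from its blocks:
in the last nontrivial row these commute and their product is that row, so that the nonzero blocks
may be cleared one at a time. -/
theorem mem_of_forall_elemBlock_mem {D : Subgroup (SL2n n F)} {X : SL2n n F}
    (hX : IsUni (X : BlockMat n F))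
    (h : ∀ i j : Fin n, ∀ hij : i < j, elemBlock hij (blk (X : BlockMat n F) i j) ∈ D) : X ∈ D := by
  classical
  induction hm : (Finset.univ.filter fun p : Fin n × Fin n =>
    p.1 < p.2 ∧ blk (X : BlockMat n F) p.1 p.2 ≠ 0).card using Nat.strong_induction_on
    generalizing X with
  | _ m ih =>
  set s := Finset.univ.filter fun p : Fin n × Fin n =>
    p.1 < p.2 ∧ blk (X : BlockMat n F) p.1 p.2 ≠ 0 with hs
  rcases s.eq_empty_or_nonempty with h0 | hne
  · have : X = 1 := by
      apply Subtype.ext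
      refine blk_ext fun i j => ?_
      rw [Matrix.SpecialLinearGroup.coe_one, blk_one]
      rcases lt_trichotomy i j with hij | rfl | hij
      · rw [if_neg hij.ne]
        by_contra hb
        have : (i, j) ∈ s := Finset.mem_filter.2 ⟨Finset.mem_univ _, hij, hb⟩
        simp [h0] at this
      · rw [if_pos rfl, hX.1]
      · rw [if_neg hij.ne', hX.2 i j hij]
    rw [this]
    exact one_mem D
  · obtain ⟨⟨r, c⟩, hrc, hmax⟩ := s.exists_max_image Prod.fst hne
    obtain ⟨-, hlt, hb⟩ := Finset.mem_filter.1 hrc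
    dsimp only at hlt hb hmax
    have hrow : ∀ j, blk (X : BlockMat n F) c j = if c = j then 1 else 0 := by
      intro j
      rcases lt_trichotomy c j with hcj | rfl | hcj
      · rw [if_neg hcj.ne]
        by_contra hb'
        exact (hmax (c, j) (Finset.mem_filter.2 ⟨Finset.mem_univ _, hcj, hb'⟩)).not_gt hlt
      · rw [if_pos rfl, hX.1]
      · rw [if_neg hcj.ne', hX.2 c j hcj]
    set B := blk (X : BlockMat n F) r c with hB
    have hY : ∀ i j, blk ((elemBlock hlt (-B) * X : SL2n n F) : BlockMat n F) i j =
        if i = r ∧ j = c then 0 else blk (X : BlockMat n F) i j := by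
      intro i j
      rw [Matrix.SpecialLinearGroup.coe_mul, coe_elemBlock, add_mul, one_mul, blk_add,
        blk_singleBlock_mul, hrow]
      by_cases hi : i = r
      · by_cases hj : j = c
        · subst hi hj
          simp [← hB]
        · simp [hj, Ne.symm hj]
      · simp [hi]
    have hmem : elemBlock hlt (-B) * X ∈ D := by
      refine ih _ ?_ ?_ ?_ rfl
      · rw [← hm]
        refine Finset.card_lt_card ⟨fun p hp => ?_, fun hsub => ?_⟩
        · obtain ⟨-, h1, h2⟩ := Finset.mem_filter.1 hp
          rw [hY] at h2
          split_ifs at h2 with hp'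
          · exact absurd rfl h2
          · exact Finset.mem_filter.2 ⟨Finset.mem_univ _, h1, h2⟩
        · have := (Finset.mem_filter.1 (hsub hrc)).2.2
          rw [hY, if_pos ⟨rfl, rfl⟩] at this
          exact this rfl
      · rw [Matrix.SpecialLinearGroup.coe_mul]
        exact (isUni_one_add_singleBlock hlt _).mul hX
      · intro i j hij
        rw [hY]
        split_ifs
        · rw [elemBlock_zero]
          exact one_mem D
        · exact h i j hij
    have := mul_mem (h r c hlt) hmem
    rwa [elemBlock_neg, mul_inv_cancel_left] at this

end Elementary

/-! ### The filtration by block diagonals -/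

section Filtration

variable {n : ℕ} {F : Type*} [Field F]

variable (n F) in
/-- The block matrices whose `(i, j)` block vanishes for `j < i + k`. -/
def strip (k : ℕ) : AddSubgroup (BlockMat n F) where
  carrier := {X | ∀ i j : Fin n, (j : ℕ) < i + k → blk X i j = 0}
  zero_mem' _ _ _ := rfl
  add_mem' hX hY i j h := by rw [blk_add, hX i j h, hY i j h, add_zero]
  neg_mem' {X} hX i j h := by
    rw [← zero_sub, blk_sub, hX i j h, sub_zero]
    rfl

theorem mul_mem_strip {k l : ℕ} {X Y : BlockMat n F} (hX : X ∈ strip n F k) (hY : Y ∈ strip n F l) :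
    X * Y ∈ strip n F (k + l) := by
  intro i j h
  rw [blk_mul]
  refine Finset.sum_eq_zero fun m _ => ?_
  rcases lt_or_ge (m : ℕ) (i + k) with h' | h'
  · rw [hX i m h', zero_mul]
  · rw [hY m j (by omega), mul_zero]

theorem isUni_iff {X : BlockMat n F} : IsUni X ↔ X - 1 ∈ strip n F 1 := by
  refine ⟨fun h i j hij => ?_, fun h => ⟨fun i => ?_, fun i j hij => ?_⟩⟩
  · rw [blk_sub, blk_one]
    rcases eq_or_ne i j with rfl | hne
    · rw [if_pos rfl, h.1, sub_self]
    · have hji : j < i := Fin.lt_def.2 (by have := Fin.val_ne_of_ne hne; omega)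
      rw [if_neg hne, h.2 i j hji, sub_zero]
  · have := h i i (by omega)
    rwa [blk_sub, blk_one, if_pos rfl, sub_eq_zero] at this
  · have := h i j (by have := Fin.lt_def.1 hij; omega)
    rwa [blk_sub, blk_one, if_neg hij.ne', sub_zero] at this

theorem IsUni.mem_strip {X : BlockMat n F} (hX : IsUni X) : X ∈ strip n F 0 := fun i j h =>
  hX.2 i j h

theorem strip_antitone : Antitone (strip n F) := fun _ _ h _ hX i j hij => hX i j (by omega)

theorem coe_mul_inv_cancel (X : SL2n n F) :
    (X : BlockMat n F) * ((X⁻¹ : SL2n n F) : BlockMat n F) = 1 := by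
  rw [← Matrix.SpecialLinearGroup.coe_mul, mul_inv_cancel, Matrix.SpecialLinearGroup.coe_one]

variable (n F) in
/-- The block unitriangular matrices whose first `k` block superdiagonals vanish. -/
def uniFiltration (k : ℕ) : Subgroup (SL2n n F) where
  carrier := {X | (X : BlockMat n F) - 1 ∈ strip n F (k + 1)}
  one_mem' := by simp
  mul_mem' {X Y} hX hY := by
    have hU : IsUni (X : BlockMat n F) := isUni_iff.2 (strip_antitone (by omega) hX)
    have := add_mem (mul_mem_strip hU.mem_strip hY) (strip_antitone (by omega) hX)
    rw [Nat.zero_add] at this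
    rw [Set.mem_ofPred_eq, Matrix.SpecialLinearGroup.coe_mul]
    convert this using 1
    noncomm_ring
  inv_mem' {X} hX := by
    have hU : IsUni (X : BlockMat n F) := isUni_iff.2 (strip_antitone (by omega) hX)
    have := neg_mem (mul_mem_strip hX hU.inv.mem_strip)
    rw [sub_mul, coe_mul_inv_cancel, one_mul, neg_sub] at this
    exact this

theorem mem_uniFiltration {k : ℕ} {X : SL2n n F} :
    X ∈ uniFiltration n F k ↔ (X : BlockMat n F) - 1 ∈ strip n F (k + 1) := Iff.rfl

/-- This is `[X, Y] - 1 = (X Y - Y X) X⁻¹ Y⁻¹`. -/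
theorem commutatorElement_mem_uniFiltration {k : ℕ} {X Y : SL2n n F}
    (hX : ((X⁻¹ : SL2n n F) : BlockMat n F) ∈ strip n F 0)
    (hY : ((Y⁻¹ : SL2n n F) : BlockMat n F) ∈ strip n F 0)
    (h : (X * Y - Y * X : BlockMat n F) ∈ strip n F (k + 1)) : ⁅X, Y⁆ ∈ uniFiltration n F k := by
  have := mul_mem_strip (mul_mem_strip h hX) hY
  rw [mem_uniFiltration, commutatorElement_def, Matrix.SpecialLinearGroup.coe_mul,
    Matrix.SpecialLinearGroup.coe_mul, Matrix.SpecialLinearGroup.coe_mul]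
  rw [sub_mul, sub_mul, mul_assoc (Y : BlockMat n F), coe_mul_inv_cancel, mul_one,
    coe_mul_inv_cancel] at this
  exact this

theorem mul_sub_mul_mem_strip {k l : ℕ} {X Y : BlockMat n F} (hX : X - 1 ∈ strip n F k)
    (hY : Y - 1 ∈ strip n F l) : X * Y - Y * X ∈ strip n F (k + l) := by
  -- `X Y - Y X = (X - 1) (Y - 1) - (Y - 1) (X - 1)`
  have h := sub_mem (mul_mem_strip hX hY) (Nat.add_comm l k ▸ mul_mem_strip hY hX)
  convert h using 1
  noncomm_ring

variable (n F)

theorem isUni_of_mem_M {X : SL2n n F} (hX : X ∈ M n F) : IsUni (X : BlockMat n F) :=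
  ⟨hX.1, hX.2.1⟩

theorem N_le_M : N n F ≤ M n F := fun _ hX => hX.1

theorem N_le_uniFiltration : N n F ≤ uniFiltration n F 0 := fun _ hX =>
  isUni_iff.1 (isUni_of_mem_M n F hX.1)

/-- The matrices in `N` are subject to no condition above the superdiagonal. -/
theorem uniFiltration_one_le_N : uniFiltration n F 1 ≤ N n F := by
  intro X hX
  have hU : IsUni (X : BlockMat n F) := isUni_iff.2 (strip_antitone (by omega) hX)
  have h0 : ∀ i j : Fin n, (j : ℕ) = i + 1 → blk (X : BlockMat n F) i j = 0 := by
    intro i j hij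
    have := hX i j (by omega)
    rwa [blk_sub, blk_one_super i j hij, sub_zero] at this
  exact ⟨⟨hU.1, hU.2, fun i j hij => by rw [h0 i j hij, Matrix.trace_zero]⟩,
    fun i j hij => ⟨0, by rw [h0 i j hij, zero_smul]⟩⟩

theorem H_le_normalizer_M : H n F ≤ Subgroup.normalizer (M n F : Subgroup _) := by
  have key : ∀ X ∈ H n F, ∀ Y ∈ M n F, X * Y * X⁻¹ ∈ M n F := by
    intro X hX Y hY
    rw [H_eq_range] at hX
    obtain ⟨A, rfl⟩ := hX
    have hA : (A : Matrix (Fin 2) (Fin 2) F) *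
        ((A⁻¹ : Matrix.SpecialLinearGroup (Fin 2) F) : Matrix (Fin 2) (Fin 2) F) = 1 := by
      rw [← Matrix.SpecialLinearGroup.coe_mul, mul_inv_cancel, Matrix.SpecialLinearGroup.coe_one]
    have hblk : ∀ i j, blk ((diagHom n A * Y * (diagHom n A)⁻¹ : SL2n n F) : BlockMat n F) i j =
        A * blk (Y : BlockMat n F) i j * (A⁻¹ : Matrix.SpecialLinearGroup (Fin 2) F) := by
      intro i j
      rw [← map_inv, Matrix.SpecialLinearGroup.coe_mul, Matrix.SpecialLinearGroup.coe_mul,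
        coe_diagHom, coe_diagHom, blk_mul_diagBlock, blk_diagBlock_mul]
    refine ⟨fun i => ?_, fun i j hij => ?_, fun i j hij => ?_⟩
    · rw [hblk, hY.1, mul_one, hA]
    · rw [hblk, hY.2.1 i j hij, mul_zero, zero_mul]
    · rw [hblk, Matrix.trace_mul_comm, ← mul_assoc, ← Matrix.SpecialLinearGroup.coe_mul,
        inv_mul_cancel, Matrix.SpecialLinearGroup.coe_one, one_mul, hY.2.2 i j hij]
  intro X hX
  rw [Subgroup.mem_normalizer_iff]
  refine fun Y => ⟨key X hX Y, fun hY => ?_⟩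
  have := key X⁻¹ (inv_mem hX) _ hY
  rwa [show X⁻¹ * (X * Y * X⁻¹) * X⁻¹⁻¹ = Y by group] at this

theorem coe_G : (G n F : Set (SL2n n F)) = (H n F : Set _) * (M n F : Set _) :=
  Subgroup.coe_mul_of_left_le_normalizer_right _ _ (H_le_normalizer_M n F)

theorem G_le_normalizer_M : G n F ≤ Subgroup.normalizer (M n F : Subgroup _) :=
  sup_le (H_le_normalizer_M n F) Subgroup.le_normalizer

theorem M_le_G : M n F ≤ G n F := le_sup_right

theorem N_le_G : N n F ≤ G n F := (N_le_M n F).trans (M_le_G n F)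

variable {n F}

theorem diagBlock_mem_strip (A : Matrix (Fin 2) (Fin 2) F) : diagBlock n A ∈ strip n F 0 :=
  fun i j h => by rw [blk_diagBlock, if_neg (by rintro rfl; omega)]

theorem mem_strip_of_mem_G {X : SL2n n F} (hX : X ∈ G n F) : (X : BlockMat n F) ∈ strip n F 0 := by
  rw [← SetLike.mem_coe, coe_G] at hX
  obtain ⟨Y, ⟨A, hA⟩, Z, hZ, rfl⟩ := hX
  rw [Matrix.SpecialLinearGroup.coe_mul, hA]
  exact mul_mem_strip (diagBlock_mem_strip _) (isUni_of_mem_M n F hZ).mem_strip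

variable (n F)

/-- `G` acts trivially on the superdiagonal blocks of `N`, because these are scalar. -/
theorem commutator_G_N_le : ⁅G n F, N n F⁆ ≤ uniFiltration n F 1 := by
  rw [Subgroup.commutator_le]
  intro X hX Y hY
  refine commutatorElement_mem_uniFiltration (mem_strip_of_mem_G (inv_mem hX))
    (mem_strip_of_mem_G (inv_mem (N_le_G n F hY))) ?_
  rw [← SetLike.mem_coe, coe_G] at hX
  obtain ⟨Z, ⟨A, hA⟩, W, hW, rfl⟩ := hX
  have hYu := N_le_uniFiltration n F hY
  have hW' := isUni_of_mem_M n F hW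
  have h1 := mul_mem_strip (diagBlock_mem_strip (n := n) (A : Matrix (Fin 2) (Fin 2) F))
    (mul_sub_mul_mem_strip (isUni_iff.1 hW') hYu)
  have h2 : diagBlock n (A : Matrix (Fin 2) (Fin 2) F) * (Y : BlockMat n F) -
      (Y : BlockMat n F) * diagBlock n (A : Matrix (Fin 2) (Fin 2) F) ∈ strip n F 2 := by
    intro i j hij
    rw [blk_sub, blk_diagBlock_mul, blk_mul_diagBlock]
    rcases lt_trichotomy j i with h | rfl | h
    · rw [hY.1.2.1 i j h, mul_zero, zero_mul, sub_zero]
    · rw [hY.1.1, mul_one, one_mul, sub_self]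
    · obtain ⟨a, ha⟩ := hY.2 i j (by have := Fin.lt_def.1 h; omega)
      rw [ha]
      simp
  -- `Δ(A) W Y - Y Δ(A) W = Δ(A) (W Y - Y W) + (Δ(A) Y - Y Δ(A)) W`
  have h3 := add_mem (strip_antitone (show 2 ≤ _ by omega) h1)
    (strip_antitone (show 2 ≤ _ by omega) (mul_mem_strip h2 hW'.mem_strip))
  rw [Matrix.SpecialLinearGroup.coe_mul, hA]
  convert h3 using 1
  noncomm_ring

theorem G_le_normalizer_N : G n F ≤ Subgroup.normalizer (N n F : Subgroup _) :=
  Subgroup.le_normalizer_iff_commutator_le_right.2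
    ((commutator_G_N_le n F).trans (uniFiltration_one_le_N n F))

theorem NinG_normal : (NinG n F).Normal :=
  Subgroup.normal_subgroupOf_of_le_normalizer (G_le_normalizer_N n F)

theorem map_iterComm_NinG_le {d : ℕ} (hd : 1 ≤ d) :
    (iterComm (NinG n F) d).map (G n F).subtype ≤ uniFiltration n F d := by
  have hN : (NinG n F).map (G n F).subtype = N n F :=
    Subgroup.map_subgroupOf_eq_of_le (N_le_G n F)
  induction d, hd using Nat.le_induction with
  | base =>
    refine (le_of_eq ?_).trans (commutator_G_N_le n F)
    rw [iterComm, iterComm, Subgroup.map_commutator, hN, ← MonoidHom.range_eq_map,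
      Subgroup.range_subtype]
  | succ d hd ih =>
    rw [iterComm, Subgroup.map_commutator, hN]
    refine (Subgroup.commutator_mono ih le_rfl).trans ?_
    rw [Subgroup.commutator_le]
    intro X hX Y hY
    have hYu := N_le_uniFiltration n F hY
    have hXU : IsUni (X : BlockMat n F) := isUni_iff.2 (strip_antitone (by omega) hX)
    exact commutatorElement_mem_uniFiltration hXU.inv.mem_strip (isUni_iff.2 hYu).inv.mem_strip
      (mul_sub_mul_mem_strip hX hYu)

theorem elemBlock_mem_M {i j : Fin n} (h : i < j) {A : Matrix (Fin 2) (Fin 2) F}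
    (hA : A.trace = 0) : elemBlock h A ∈ M n F := by
  have hU := isUni_one_add_singleBlock h A
  refine ⟨hU.1, hU.2, fun k l hkl => ?_⟩
  rw [coe_elemBlock, blk_add, blk_one_super k l hkl, blk_singleBlock, zero_add]
  split_ifs
  · exact hA
  · exact Matrix.trace_zero _ _

/-- In characteristic two the identity block has trace zero. -/
theorem elemBlock_one_mem_N [CharP F 2] {i j : Fin n} (h : i < j) :
    elemBlock h (1 : Matrix (Fin 2) (Fin 2) F) ∈ N n F := by
  refine ⟨elemBlock_mem_M n F h (by simp [CharTwo.two_eq_zero]), fun k l hkl => ?_⟩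
  rw [coe_elemBlock, blk_add, blk_one_super k l hkl, blk_singleBlock, zero_add]
  split_ifs
  · exact ⟨1, (one_smul _ _).symm⟩
  · exact ⟨0, (zero_smul _ _).symm⟩

/-- The block transvection with identity block in place `(0, d)` lies in `γ_d(N)`, `d = e + 1`, as
an iterated commutator of those in the places `(i, i + 1)`. -/
theorem elemBlock_one_mem_lowerCentralSeries [CharP F 2] (e : ℕ) (he : e + 1 < n) :
    elemBlock (show (⟨0, by omega⟩ : Fin n) < ⟨e + 1, he⟩ from Fin.lt_def.2 (Nat.succ_pos e))
      (1 : Matrix (Fin 2) (Fin 2) F) ∈ (N n F).lowerCentralSeries e := by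
  induction e with
  | zero => exact elemBlock_one_mem_N n F _
  | succ e ih =>
    have h := commutatorElement_elemBlock (F := F)
      (show (⟨0, by omega⟩ : Fin n) < ⟨e + 1, by omega⟩ from Fin.lt_def.2 (Nat.succ_pos e))
      (show (⟨e + 1, by omega⟩ : Fin n) < ⟨e + 1 + 1, he⟩ from Fin.lt_def.2 (Nat.lt_succ_self _))
      1 1
    rw [mul_one] at h
    rw [← h]
    exact Subgroup.commutator_mem_commutator (ih _) (elemBlock_one_mem_N n F _)

theorem iterComm_NinG_lt [CharP F 2] {d : ℕ} (hd : 1 ≤ d) (hdn : d < n) :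
    iterComm (NinG n F) d < gammaSub d (NinG n F) := by
  have := NinG_normal n F
  refine lt_of_le_not_ge (iterComm_le_gammaSub _ d hd) fun hle => ?_
  obtain ⟨e, rfl⟩ := Nat.exists_eq_add_of_le' hd
  have h1 := (Subgroup.map_mono hle).trans (map_iterComm_NinG_le n F hd)
  rw [gammaSub, Nat.add_sub_cancel, Subgroup.map_lowerCentralSeries, NinG,
    Subgroup.map_subgroupOf_eq_of_le (N_le_G n F)] at h1
  have h2 := h1 (elemBlock_one_mem_lowerCentralSeries n F e hdn) ⟨0, by omega⟩ ⟨e + 1, hdn⟩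
    (by simp)
  rw [blk_sub, blk_elemBlock_self, blk_one, if_neg (by simp [Fin.ext_iff]), sub_zero] at h2
  exact one_ne_zero h2

end Filtration

/-! ### Perfectness -/

section Perfect

open Matrix.SpecialLinearGroup in
/-- All block transvections with a block of trace zero are products of commutators, because
conjugation by `SL₂(F)` has no nonzero coinvariants on the `2 × 2` matrices of trace zero. -/
theorem elemBlock_mem_commutator_of_trace_eq_zero {n : ℕ} {F : Type*} [Field F] [CharP F 2] {t : F}
    (ht : t ≠ 0) (ht' : t ^ 2 ≠ 1) {i j : Fin n} (h : i < j) {A : Matrix (Fin 2) (Fin 2) F}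
    (hA : A.trace = 0) : elemBlock h A ∈ ⁅G n F, G n F⁆ := by
  have hconj : ∀ (S : Matrix.SpecialLinearGroup (Fin 2) F) (B : Matrix (Fin 2) (Fin 2) F),
      B.trace = 0 → elemBlock h ((S : Matrix (Fin 2) (Fin 2) F) * B *
        ((S⁻¹ : Matrix.SpecialLinearGroup (Fin 2) F) : Matrix (Fin 2) (Fin 2) F) - B) ∈
          ⁅G n F, G n F⁆ := fun S B hB => by
    rw [← commutatorElement_diagHom_elemBlock]
    exact Subgroup.commutator_mem_commutator ((le_sup_left : H n F ≤ G n F) (diagHom_mem_H S))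
      (M_le_G n F (elemBlock_mem_M n F h hB))
  have hne : t ^ 2 - 1 ≠ 0 := sub_ne_zero.2 ht'
  have hne' : (t⁻¹) ^ 2 - 1 ≠ 0 := sub_ne_zero.2 (by rwa [inv_pow, ne_eq, inv_eq_one])
  -- the diagonal matrices of `SL₂(F)` scale `E₁₂` by `t ^ 2`, and `E₂₁` by its inverse
  have hup : ∀ x : F, elemBlock h !![0, x; 0, 0] ∈ ⁅G n F, G n F⁆ := by
    intro x
    obtain ⟨y, rfl⟩ : ∃ y, x = y * (t ^ 2 - 1) := ⟨_, (div_mul_cancel₀ x hne).symm⟩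
    have := hconj (diag2 t ht) !![0, y; 0, 0] (by simp [Matrix.trace_fin_two])
    rw [diag2_inv] at this
    convert this using 2
    ext a b
    fin_cases a <;> fin_cases b <;> simp [Matrix.mul_apply, diag2_coe]
    ring
  have hlo : ∀ x : F, elemBlock h !![0, 0; x, 0] ∈ ⁅G n F, G n F⁆ := by
    intro x
    obtain ⟨y, rfl⟩ : ∃ y, x = y * (t⁻¹ ^ 2 - 1) := ⟨_, (div_mul_cancel₀ x hne').symm⟩
    have := hconj (diag2 t ht) !![0, 0; y, 0] (by simp [Matrix.trace_fin_two])
    rw [diag2_inv] at this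
    convert this using 2
    ext a b
    fin_cases a <;> fin_cases b <;> simp [Matrix.mul_apply, diag2_coe]
    ring
  have hscalar : ∀ x : F, elemBlock h !![x, 0; 0, x] ∈ ⁅G n F, G n F⁆ := by
    intro x
    -- conjugating `x E₁₂` by `1 + E₂₁` adds `x (1 + E₂₁)` to it, in characteristic two
    have := hconj (transvection one_ne_zero 1) !![0, x; 0, 0] (by simp [Matrix.trace_fin_two])
    have := mul_mem this (hlo x)
    rw [← elemBlock_add] at this
    convert this using 2
    ext a b
    fin_cases a <;> fin_cases b <;>
      simp [Matrix.mul_apply, Matrix.adjugate_fin_two, transvection_coe, CharTwo.neg_eq,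
        CharTwo.add_self_eq_zero]
  have hdecomp : A = !![0, A 0 1; 0, 0] + !![0, 0; A 1 0, 0] + !![A 0 0, 0; 0, A 0 0] := by
    rw [Matrix.trace_fin_two, CharTwo.add_eq_zero] at hA
    ext a b
    fin_cases a <;> fin_cases b <;> simp [hA]
  rw [hdecomp, elemBlock_add, elemBlock_add]
  exact mul_mem (mul_mem (hup _) (hlo _)) (hscalar _)

/-- Two superdiagonals or more above the diagonal there is no condition on the trace: products of
two `2 × 2` matrices of trace zero span all `2 × 2` matrices. -/
theorem elemBlock_mem_commutator {n : ℕ} {F : Type*} [Field F] [CharP F 2] {t : F}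
    (ht : t ≠ 0) (ht' : t ^ 2 ≠ 1) {i j k : Fin n} (h : i < j) (h' : j < k)
    (A : Matrix (Fin 2) (Fin 2) F) : elemBlock (h.trans h') A ∈ ⁅G n F, G n F⁆ := by
  have hmul : ∀ B C : Matrix (Fin 2) (Fin 2) F, B.trace = 0 → C.trace = 0 →
      elemBlock (h.trans h') (B * C) ∈ ⁅G n F, G n F⁆ := by
    intro B C hB hC
    rw [← commutatorElement_elemBlock h h']
    exact Subgroup.commutator_mem_commutator (M_le_G n F (elemBlock_mem_M n F h hB))
      (M_le_G n F (elemBlock_mem_M n F h' hC))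
  have hdecomp : A = !![0, A 0 1; A 1 0, 0] + !![0, 1; 0, 0] * !![0, 0; A 0 0, 0] +
      !![0, 0; 1, 0] * !![0, A 1 1; 0, 0] := by
    ext a b
    fin_cases a <;> fin_cases b <;> simp
  rw [hdecomp, elemBlock_add, elemBlock_add]
  refine mul_mem (mul_mem ?_ ?_) ?_
  · exact elemBlock_mem_commutator_of_trace_eq_zero ht ht' _ (by simp [Matrix.trace_fin_two])
  all_goals exact hmul _ _ (by simp [Matrix.trace_fin_two]) (by simp [Matrix.trace_fin_two])

theorem isPerfect_G (n : ℕ) {F : Type*} [Field F] [CharP F 2] {t : F} (ht : t ≠ 0)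
    (ht' : t ^ 2 ≠ 1) : Group.IsPerfect (G n F) := by
  rw [Subgroup.isPerfect_iff]
  refine le_antisymm (Subgroup.commutator_le_self _) (sup_le ?_ fun X hX => ?_)
  · have hH : H n F = ⁅H n F, H n F⁆ := by
      rw [H_eq_range, MonoidHom.range_eq_map, ← Subgroup.map_commutator, ← commutator_def,
        Matrix.SL2.commutator_eq_top ht ht']
    rw [hH]
    exact Subgroup.commutator_mono le_sup_left le_sup_left
  · refine mem_of_forall_elemBlock_mem (isUni_of_mem_M n F hX) fun i j hij => ?_
    rcases eq_or_ne (j : ℕ) (i + 1) with h | h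
    · exact elemBlock_mem_commutator_of_trace_eq_zero ht ht' hij (hX.2.2 i j h)
    · have hij' := Fin.lt_def.1 hij
      exact elemBlock_mem_commutator ht ht' (j := ⟨i + 1, by omega⟩)
        (Fin.lt_def.2 (Nat.lt_succ_self _)) (Fin.lt_def.2 (by simp only; omega)) _

theorem exists_sq_ne_one_F4 : ∃ t : F4, t ≠ 0 ∧ t ^ 2 ≠ 1 := by
  by_contra! hall
  have hsub : (Set.univ : Set F4) ⊆ {0, 1} := by
    intro t _
    rcases eq_or_ne t 0 with h | h
    · exact Or.inl h
    · have := hall t h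
      rw [← one_pow 2] at this
      exact Or.inr (CharTwo.sq_injective this)
  have h1 := Set.ncard_le_ncard hsub (Set.toFinite _)
  rw [Set.ncard_univ, GaloisField.card 2 2 two_ne_zero, Set.ncard_pair zero_ne_one] at h1
  omega

end Perfect

end SubdirectPerfect

theorem mainTheorem6 (n : ℕ) (hn : 1 ≤ n) :
    -- `H` and `M` consist of matrices of determinant `1`, and `M ⊴ G = HM ≤ SL_{2n}(F₄)`
    ((∀ X ∈ SubdirectPerfect.HMat n SubdirectPerfect.F4, X.det = 1) ∧
      (∀ X ∈ SubdirectPerfect.MMat n SubdirectPerfect.F4, X.det = 1) ∧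
      (SubdirectPerfect.G n SubdirectPerfect.F4 : Set (SubdirectPerfect.SL2n n SubdirectPerfect.F4))
        = (SubdirectPerfect.H n SubdirectPerfect.F4 : Set _) *
          (SubdirectPerfect.M n SubdirectPerfect.F4 : Set _) ∧
      SubdirectPerfect.M n SubdirectPerfect.F4 ≤ SubdirectPerfect.G n SubdirectPerfect.F4 ∧
      ((SubdirectPerfect.M n SubdirectPerfect.F4).subgroupOf
        (SubdirectPerfect.G n SubdirectPerfect.F4)).Normal) ∧
    -- `G` is a finite perfect group
    (Finite (SubdirectPerfect.G n SubdirectPerfect.F4) ∧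
      Group.IsPerfect (SubdirectPerfect.G n SubdirectPerfect.F4)) ∧
    -- `N ⊴ G`
    (SubdirectPerfect.N n SubdirectPerfect.F4 ≤ SubdirectPerfect.G n SubdirectPerfect.F4 ∧
      (SubdirectPerfect.NinG n SubdirectPerfect.F4).Normal) ∧
    -- `γ_d(N) > [G, N, …, N]` (`d` copies of `N`)
    (∀ d : ℕ, 1 ≤ d → d < n →
      SubdirectPerfect.iterComm (SubdirectPerfect.NinG n SubdirectPerfect.F4) d <
        SubdirectPerfect.gammaSub d (SubdirectPerfect.NinG n SubdirectPerfect.F4)) ∧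
    -- `Γ_1(G, N)` is a subdirect subgroup of `G ^ (2 ^ d)` with a nilpotent quotient of class `d`
    (∀ d : ℕ, d < n →
      ∃ S : Subgroup (Finset (Fin d) → SubdirectPerfect.G n SubdirectPerfect.F4),
        (S : Set _) =
          SubdirectPerfect.GammaSet d 1 (SubdirectPerfect.NinG n SubdirectPerfect.F4) ∧
        SubdirectPerfect.IsSubdirect S ∧
        SubdirectPerfect.HasNilpotentQuotientOfClass S d) := by
  have hN := SubdirectPerfect.NinG_normal n SubdirectPerfect.F4
  obtain ⟨t, ht, ht'⟩ := SubdirectPerfect.exists_sq_ne_one_F4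
  refine ⟨⟨?_, fun X hX => ?_, SubdirectPerfect.coe_G n _, SubdirectPerfect.M_le_G n _,
    Subgroup.normal_subgroupOf_of_le_normalizer (SubdirectPerfect.G_le_normalizer_M n _)⟩,
    ⟨inferInstance, SubdirectPerfect.isPerfect_G n ht ht'⟩,
    ⟨SubdirectPerfect.N_le_G n _, hN⟩,
    fun d hd hdn => SubdirectPerfect.iterComm_NinG_lt n _ hd hdn, fun d hdn => ?_⟩
  · rintro _ ⟨A, rfl⟩
    rw [SubdirectPerfect.det_diagBlock, A.2, one_pow]
  · exact SubdirectPerfect.IsUni.det_eq_one ⟨hX.1, hX.2.1⟩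
  · exact ⟨SubdirectPerfect.gammaGroup _ d 1, (SubdirectPerfect.gammaSet_one_eq _ d).symm,
      SubdirectPerfect.isSubdirect_gammaGroup_one _ d,
      SubdirectPerfect.hasNilpotentQuotientOfClass_gammaGroup_one _ fun hd =>
        SubdirectPerfect.iterComm_NinG_lt n _ hd hdn⟩
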